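/- **Proposition 5.2.** Let $V$ be a finite-dimensional real inner product space and let $G$ be a reflection group on $V$, i.e. a finite group of orthogonal transformations of $V$ generated by reflections in linear hyperplanes. Assume that $G$ is irreducible (it is not the internal direct product of two nontrivial subgroups that are themselves reflection groups on $V$) and essential (it fixes no nonzero vector). Let $\mathcal H(G)$ be the set of reflection hyperplanes of $G$, i.e. the fixed hyperplanes of the reflections in $G$. A flat is an intersection of members of $\mathcal H(G)$ (the empty intersection being $V$), and $\mathcal H_i$ denotes the set of points of $V$ that lie in some flat of dimension $i$. The roots of $G$ are the unit normal vectors of its reflection hyperplanes. A simple system is a linearly independent set $\Delta$ of roots such that every root is a linear combination of $\Delta$ with all coefficients $\ge 0$ or all coefficients $\le 0$. The Dynkin diagram $D$ of $G$ is the labelled graph with node set $\Delta$ in which distinct $\alpha,\beta$ carry the label $m(\alpha,\beta)=$ the order of $s_\alpha s_\beta$, and are joined by an edge exactly when $m(\alpha,\beta)\ge 3$ ($s_\alpha$ is the reflection in $\alpha^\perp$). A subdiagram consists of a subset of the nodes together with all edges and labels between them. A parabolic subgroup of $G$ is a subgroup generated by $\{s_\alpha:\alpha\in I\}$ for a subset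 $I$ of some simple system of $G$. A subgroup has Dynkin diagram $D'$ if its diagram is isomorphic to $D'$ as a labelled graph. For a reflection group $W$ on $V$, a point $p\in V$ is $W$-general if it lies on no reflection hyperplane of $W$. Let $k\ge 1$, let $p\in\mathcal H_k\setminus\mathcal H_{k-1}$, and let $D'\subseteq D$ be a connected subdiagram on $k$ nodes. Then there is a parabolic subgroup $W\subseteq G$ with Dynkin diagram $D'$ such that $p$ is $W$-general. -/

import Mathlib

/-!
Finite real reflection groups on a Euclidean space `V`, their reflection arrangements and strata,
simple systems, Dynkin diagrams (as labelled graphs, encoded by Coxeter matrices) and parabolic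
subgroups.
-/

noncomputable section

namespace ReflGroup

section Groups

variable {V : Type*} [NormedAddCommGroup V] [InnerProductSpace ℝ V]

/-- The linear hyperplane orthogonal to `α` (for `α ≠ 0`). -/
def hyperplane (α : V) : Submodule ℝ V := (Submodule.span ℝ {α})ᗮ

/-- The orthogonal reflection of `V` in the hyperplane orthogonal to `α`. -/
def refl (α : V) : V ≃ₗᵢ[ℝ] V := ((Submodule.span ℝ {α})ᗮ).reflection

/-- The roots of `G`: the unit normal vectors of the reflections contained in `G`. -/
def roots (G : Subgroup (V ≃ₗᵢ[ℝ] V)) : Set V := {α | ‖α‖ = 1 ∧ refl α ∈ G}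

/-- A (real) reflection group: a finite group of orthogonal transformations of `V` that is
generated by the reflections it contains. The trivial group is one. -/
def IsReflectionGroup (G : Subgroup (V ≃ₗᵢ[ℝ] V)) : Prop :=
  (G : Set (V ≃ₗᵢ[ℝ] V)).Finite ∧ G = Subgroup.closure (refl '' roots G)

/-- `G` is not the (internal direct) product of two nontrivial reflection groups. -/
def IsIrreducible (G : Subgroup (V ≃ₗᵢ[ℝ] V)) : Prop :=
  ¬ ∃ G₁ G₂ : Subgroup (V ≃ₗᵢ[ℝ] V),
      IsReflectionGroup G₁ ∧ IsReflectionGroup G₂ ∧ G₁ ≠ ⊥ ∧ G₂ ≠ ⊥ ∧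
      (∀ g₁ ∈ G₁, ∀ g₂ ∈ G₂, g₁ * g₂ = g₂ * g₁) ∧ G₁ ⊓ G₂ = ⊥ ∧ G₁ ⊔ G₂ = G

/-- `G` fixes no nonzero vector. -/
def IsEssential (G : Subgroup (V ≃ₗᵢ[ℝ] V)) : Prop :=
  ∀ v : V, (∀ g ∈ G, g v = v) → v = 0

/-- The reflection arrangement of `G`: the set of its reflection hyperplanes. -/
def arrangement (G : Subgroup (V ≃ₗᵢ[ℝ] V)) : Set (Submodule ℝ V) := hyperplane '' roots G

/-- A flat: an intersection of reflection hyperplanes (the empty intersection is `V`). -/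
def IsFlat (G : Subgroup (V ≃ₗᵢ[ℝ] V)) (F : Submodule ℝ V) : Prop :=
  ∃ S ⊆ arrangement G, F = sInf S

/-- The `i`-th stratum: the set of points contained in a flat of dimension `i`. -/
def stratum (G : Subgroup (V ≃ₗᵢ[ℝ] V)) (i : ℕ) : Set V :=
  {p | ∃ F : Submodule ℝ V, IsFlat G F ∧ Module.finrank ℝ F = i ∧ p ∈ F}

/-- `p` is `G`-general: it lies on no reflection hyperplane of `G`. -/
def IsGeneral (G : Subgroup (V ≃ₗᵢ[ℝ] V)) (p : V) : Prop :=
  ∀ H ∈ arrangement G, p ∉ H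

/-- A simple system of `G`: a linearly independent set of roots such that every root is a linear
combination of its elements with all coefficients nonnegative or all coefficients nonpositive. -/
def IsSimpleSystem (G : Subgroup (V ≃ₗᵢ[ℝ] V)) (Δ : Set V) : Prop :=
  Δ ⊆ roots G ∧ LinearIndepOn ℝ id Δ ∧
    ∀ β ∈ roots G, β ∈ PointedCone.hull ℝ Δ ∨ -β ∈ PointedCone.hull ℝ Δ

/-- The labelled graph encoded by `D` is the Dynkin diagram of `G` (up to relabelling of nodes):
its nodes are in bijection with a simple system of `G`, and the label of a pair of nodes is the
order of the product of the two corresponding simple reflections. -/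
def HasDynkinDiagram (G : Subgroup (V ≃ₗᵢ[ℝ] V)) {B : Type*} (D : CoxeterMatrix B) : Prop :=
  ∃ α : B → V, Function.Injective α ∧ IsSimpleSystem G (Set.range α) ∧
    ∀ i j, D i j = orderOf (refl (α i) * refl (α j))

/-- A parabolic subgroup of `G`: one generated by the reflections in a subset of some simple
system of `G`. -/
def IsParabolic (G W : Subgroup (V ≃ₗᵢ[ℝ] V)) : Prop :=
  ∃ Δ : Set V, IsSimpleSystem G Δ ∧ ∃ I ⊆ Δ, W = Subgroup.closure (refl '' I)

end Groups

section Diagrams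

/-- The subdiagram of `D` on a set `I` of nodes, with all edges and labels inherited from `D`. -/
def subdiagram {B : Type*} (D : CoxeterMatrix B) (I : Finset B) : CoxeterMatrix I where
  M := fun i j => D i j
  isSymm := Matrix.IsSymm.ext fun i j => D.symmetric j i
  diagonal := fun i => D.diagonal i
  off_diagonal := fun i j h => D.off_diagonal i j fun h' => h (Subtype.ext h')

/-- The underlying graph of a diagram: two distinct nodes are joined by an edge unless their
label is `2`. -/
def diagramGraph {B : Type*} (D : CoxeterMatrix B) : SimpleGraph B where
  Adj i j := i ≠ j ∧ D i j ≠ 2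
  symm := ⟨fun i j h => ⟨h.1.symm, by rw [D.symmetric j i]; exact h.2⟩⟩
  loopless := ⟨fun _ h => h.1 rfl⟩

end Diagrams

end ReflGroup

end

namespace ReflGroup

variable {V : Type*} [NormedAddCommGroup V] [InnerProductSpace ℝ V]

open Submodule Module

/-! Let `L` be the span of the simple roots in `I`, of dimension at most `k`, and let `F` be a
`k`-flat through `p`. Since `p` lies in no `(k - 1)`-flat, every root orthogonal to `p` lies in `Fᗮ`
(`mem_orthogonal_flat`). Conjugating the standard parabolic by `g ∈ G` keeps its diagram and moves
its roots into `g L`, so it suffices that `g L ⊓ Fᗮ = ⊥`. Such a `g` exists by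
`exists_map_inf_eq_bot`. If `L ⊓ U` contains `x ≠ 0`, the dimension bound makes `L ⊔ U` proper. By
irreducibility the roots outside a proper subspace span `V` (`span_roots_diff_eq_top`), so some root
`γ` outside `L ⊔ U` is not orthogonal to `x`. Reflecting `L` in `γ` strictly shrinks its
intersection with `U`; iterate. -/

lemma mem_hyperplane_iff {α v : V} : v ∈ hyperplane α ↔ inner ℝ α v = 0 :=
  mem_orthogonal_singleton_iff_inner_right

lemma refl_apply {α : V} (hα : ‖α‖ = 1) (v : V) :
    refl α v = v - (2 * inner ℝ α v) • α := by
  rw [refl, reflection_orthogonal_apply, reflection_singleton_apply]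
  simp only [hα]
  module

lemma refl_apply_of_inner_eq_zero {α v : V} (h : inner ℝ α v = 0) : refl α v = v :=
  reflection_mem_subspace_eq_self (mem_orthogonal_singleton_iff_inner_right.2 h)

lemma refl_apply_self (α : V) : refl α α = -α :=
  reflection_orthogonalComplement_singleton_eq_neg α

omit [InnerProductSpace ℝ V] in
lemma ne_zero_of_norm_eq_one {α : V} (hα : ‖α‖ = 1) : α ≠ 0 := by
  rintro rfl
  simp at hα

lemma refl_ne_one {α : V} (hα : ‖α‖ = 1) : refl α ≠ 1 := fun h => by
  have h' : (1 : V ≃ₗᵢ[ℝ] V) α = -α := h ▸ refl_apply_self α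
  have := IsAddTorsionFree.of_isTorsionFree ℝ V
  exact ne_zero_of_norm_eq_one hα (self_eq_neg.1 h')

lemma refl_map (g : V ≃ₗᵢ[ℝ] V) {α : V} (hα : ‖α‖ = 1) : refl (g α) = g * refl α * g⁻¹ := by
  ext v
  have hgα : ‖g α‖ = 1 := by rw [g.norm_map, hα]
  obtain ⟨w, rfl⟩ := g.surjective v
  have hw : g⁻¹ (g w) = w := g.symm_apply_apply w
  rw [refl_apply hgα]
  change _ = g (refl α (g⁻¹ (g w)))
  simp only [hw, refl_apply hα, g.inner_map_map, map_sub, map_smul]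

lemma commute_refl {α β : V} (hα : ‖α‖ = 1) (hβ : ‖β‖ = 1) (h : inner ℝ α β = 0) :
    Commute (refl α) (refl β) := by
  ext v
  change refl α (refl β v) = refl β (refl α v)
  simp only [refl_apply hα, refl_apply hβ, inner_sub_right,
    inner_smul_right, h, real_inner_comm α β ▸ h]
  module

lemma map_mem_roots {G : Subgroup (V ≃ₗᵢ[ℝ] V)} {g : V ≃ₗᵢ[ℝ] V} (hg : g ∈ G) {α : V}
    (hα : α ∈ roots G) : g α ∈ roots G :=
  ⟨by rw [g.norm_map, hα.1], by
    rw [refl_map g hα.1]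
    exact G.mul_mem (G.mul_mem hg hα.2) (G.inv_mem hg)⟩

lemma roots_mono {G H : Subgroup (V ≃ₗᵢ[ℝ] V)} (h : G ≤ H) : roots G ⊆ roots H :=
  fun _ hα => ⟨hα.1, h hα.2⟩

/-- Elements of a group generated by reflections fix everything orthogonal to the generating
roots. -/
lemma apply_eq_of_mem_closure_refl {R : Set V} {g : V ≃ₗᵢ[ℝ] V}
    (hg : g ∈ Subgroup.closure (refl '' R)) {v : V} (hv : ∀ α ∈ R, inner ℝ α v = 0) :
    g v = v := by
  induction hg using Subgroup.closure_induction with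
  | mem _ h =>
    obtain ⟨α, hα, rfl⟩ := h
    exact refl_apply_of_inner_eq_zero (hv α hα)
  | one => rfl
  | mul x y _ _ hx hy => exact (congrArg x hy).trans hx
  | inv x _ hx => exact (congrArg x.symm hx).symm.trans (x.symm_apply_apply v)

lemma mem_orthogonal_span {R : Set V} {v : V} (h : ∀ γ ∈ R, inner ℝ γ v = 0) :
    v ∈ (span ℝ R)ᗮ := by
  have hle : span ℝ R ≤ (span ℝ {v})ᗮ := span_le.2 fun γ hγ =>
    mem_orthogonal_singleton_iff_inner_left.2 (h γ hγ)
  exact fun x hx => mem_orthogonal_singleton_iff_inner_left.1 (hle hx)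

/-- The roots of a group generated by reflections lie in the span of the generating roots. -/
lemma mem_span_of_mem_roots_closure [FiniteDimensional ℝ V] {R : Set V} {β : V}
    (hβ : β ∈ roots (Subgroup.closure (refl '' R))) : β ∈ span ℝ R := by
  rw [← (span ℝ R).orthogonal_orthogonal]
  intro v hv
  -- The reflection in `β` fixes every `v` orthogonal to `R`, which forces `β` to be orthogonal to
  -- `v`.
  have h := apply_eq_of_mem_closure_refl hβ.2 (v := v) fun α hα => hv α (subset_span hα)
  rw [refl_apply hβ.1, sub_eq_self, smul_eq_zero] at h
  have h2 := h.resolve_right (ne_zero_of_norm_eq_one hβ.1)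
  rw [real_inner_comm]
  linarith

lemma isReflectionGroup_closure {G : Subgroup (V ≃ₗᵢ[ℝ] V)} (hG : IsReflectionGroup G)
    {R : Set V} (hR : R ⊆ roots G) : IsReflectionGroup (Subgroup.closure (refl '' R)) := by
  have hle : Subgroup.closure (refl '' R) ≤ G := by
    rw [Subgroup.closure_le]
    rintro _ ⟨α, hα, rfl⟩
    exact (hR hα).2
  refine ⟨hG.1.subset hle, le_antisymm ?_ ?_⟩
  · refine Subgroup.closure_mono (Set.image_mono fun α hα => ⟨(hR hα).1, ?_⟩)
    exact Subgroup.subset_closure ⟨α, hα, rfl⟩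
  · rw [Subgroup.closure_le]
    rintro _ ⟨α, hα, rfl⟩
    exact hα.2

/-- The roots of an essential reflection group span. -/
lemma span_roots_eq_top [FiniteDimensional ℝ V] {G : Subgroup (V ≃ₗᵢ[ℝ] V)}
    (hG : IsReflectionGroup G) (hess : IsEssential G) : span ℝ (roots G) = ⊤ := by
  rw [← orthogonal_eq_bot_iff, Submodule.eq_bot_iff]
  intro v hv
  refine hess v fun g hg => ?_
  rw [hG.2] at hg
  exact apply_eq_of_mem_closure_refl hg fun α hα => hv α (subset_span hα)

/-! ### Irreducibility and general position -/

/-- If every root of an irreducible essential reflection group lies in `S` or in `Sᗮ`, and some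
root lies in `S`, then `S` is everything. -/
lemma eq_top_of_forall_mem_or_mem_orthogonal [FiniteDimensional ℝ V]
    {G : Subgroup (V ≃ₗᵢ[ℝ] V)} (hG : IsReflectionGroup G) (hirr : IsIrreducible G)
    (hess : IsEssential G) {S : Submodule ℝ V} (hS : ∀ α ∈ roots G, α ∈ S ∨ α ∈ Sᗮ)
    (hne : ∃ α ∈ roots G, α ∈ S) : S = ⊤ := by
  by_cases hall : ∀ α ∈ roots G, α ∈ S
  · rw [eq_top_iff, ← span_roots_eq_top hG hess]
    exact span_le.2 hall
  push Not at hall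
  obtain ⟨α, hα, hαS⟩ := hne
  obtain ⟨β, hβ, hβS⟩ := hall
  set R₁ : Set V := roots G ∩ S
  set R₂ : Set V := roots G ∩ Sᗮ
  have ne_bot : ∀ {R : Set V} {γ : V}, γ ∈ roots G → γ ∈ R →
      Subgroup.closure (refl '' R) ≠ ⊥ := fun {R γ} hγ hγR h =>
    refl_ne_one hγ.1 ((Subgroup.eq_bot_iff_forall _).1 h _
      (Subgroup.subset_closure ⟨γ, hγR, rfl⟩))
  refine (hirr ⟨Subgroup.closure (refl '' R₁), Subgroup.closure (refl '' R₂),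
    isReflectionGroup_closure hG Set.inter_subset_left,
    isReflectionGroup_closure hG Set.inter_subset_left,
    ne_bot hα ⟨hα, hαS⟩, ne_bot hβ ⟨hβ, (hS β hβ).resolve_left hβS⟩, ?_, ?_, ?_⟩).elim
  · intro g₁ h₁ g₂ h₂
    have hle : Subgroup.closure (refl '' R₁) ≤
        Subgroup.centralizer (Subgroup.closure (refl '' R₂)) := by
      rw [Subgroup.centralizer_closure, Subgroup.closure_le]
      rintro _ ⟨γ, hγ, rfl⟩
      rw [SetLike.mem_coe, Subgroup.mem_centralizer_iff]
      rintro _ ⟨δ, hδ, rfl⟩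
      exact (commute_refl hγ.1.1 hδ.1.1 (hδ.2 γ hγ.2)).eq.symm
    exact (Subgroup.mem_centralizer_iff.1 (hle h₁) g₂ h₂).symm
  · rw [Subgroup.eq_bot_iff_forall]
    -- As an element of the second factor `g` fixes `S`; as an element of the first it fixes `Sᗮ`.
    rintro g ⟨h₁, h₂⟩
    ext v
    obtain ⟨x, hx, y, hy, rfl⟩ := S.exists_add_mem_mem_orthogonal v
    rw [map_add, apply_eq_of_mem_closure_refl h₂ fun γ hγ => ?_,
      apply_eq_of_mem_closure_refl h₁ fun γ hγ => hy γ hγ.2]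
    · rfl
    · rw [real_inner_comm]
      exact hγ.2 x hx
  · rw [← Subgroup.closure_union, ← Set.image_union, ← Set.inter_union_distrib_left]
    conv_rhs => rw [hG.2]
    rw [show roots G ∩ ((S : Set V) ∪ Sᗮ) = roots G from Set.inter_eq_left.2 hS]

/-- The roots of an irreducible essential reflection group outside a proper subspace span. -/
lemma span_roots_diff_eq_top [FiniteDimensional ℝ V] {G : Subgroup (V ≃ₗᵢ[ℝ] V)}
    (hG : IsReflectionGroup G) (hirr : IsIrreducible G) (hess : IsEssential G)
    {M : Submodule ℝ V} (hM : M ≠ ⊤) : span ℝ (roots G \ M) = ⊤ := by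
  refine eq_top_of_forall_mem_or_mem_orthogonal hG hirr hess (fun δ hδ => ?_) ?_
  · by_cases hδM : δ ∈ M
    · refine or_iff_not_imp_right.2 fun hnot => ?_
      obtain ⟨γ, hγ, hne⟩ : ∃ γ ∈ roots G \ M, inner ℝ γ δ ≠ 0 := by
        by_contra! hcon
        exact hnot (mem_orthogonal_span hcon)
      -- As `δ ∈ M`, reflecting in `δ` does not change `γ` modulo `M`. So both roots lie in the
      -- span, and their difference is a nonzero multiple of `δ`.
      have hγ' : refl δ γ ∈ roots G \ M := by
        refine ⟨map_mem_roots hδ.2 hγ.1, fun h => hγ.2 ?_⟩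
        rw [refl_apply hδ.1] at h
        simpa using M.add_mem h (M.smul_mem (2 * inner ℝ δ γ) hδM)
      have hdiff := sub_mem (subset_span (R := ℝ) hγ) (subset_span (R := ℝ) hγ')
      rw [refl_apply hδ.1, sub_sub_cancel] at hdiff
      refine (smul_mem_iff _ (mul_ne_zero two_ne_zero ?_)).1 hdiff
      rwa [real_inner_comm]
    · exact Or.inl (subset_span ⟨hδ, hδM⟩)
  · by_contra! hcon
    refine hM (top_le_iff.1 ?_)
    rw [← span_roots_eq_top hG hess, span_le]
    intro α hα
    by_contra hαM
    exact hcon α hα (subset_span ⟨hα, hαM⟩)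

/-- An irreducible essential reflection group moves subspaces of complementary (or smaller)
dimension into general position. -/
theorem exists_map_inf_eq_bot [FiniteDimensional ℝ V] {G : Subgroup (V ≃ₗᵢ[ℝ] V)}
    (hG : IsReflectionGroup G) (hirr : IsIrreducible G) (hess : IsEssential G)
    (U L : Submodule ℝ V) (hdim : finrank ℝ U + finrank ℝ L ≤ finrank ℝ V) :
    ∃ g ∈ G, L.map g.toLinearMap ⊓ U = ⊥ := by
  induction hn : finrank ℝ (L ⊓ U : Submodule ℝ V) using Nat.strong_induction_on
    generalizing L with
  | _ n ih =>
    by_cases hbot : L ⊓ U = ⊥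
    · refine ⟨1, G.one_mem, ?_⟩
      rw [← hbot]
      congr 1
      exact L.map_id
    have hM : L ⊔ U ≠ ⊤ := fun h => by
      have h1 := finrank_sup_add_finrank_inf_eq L U
      rw [h, finrank_top] at h1
      have h2 : finrank ℝ (L ⊓ U : Submodule ℝ V) ≠ 0 := by rwa [Ne, finrank_eq_zero]
      omega
    obtain ⟨x, hx, hx0⟩ := exists_mem_ne_zero_of_ne_bot hbot
    obtain ⟨γ, hγ, hne⟩ : ∃ γ ∈ roots G \ (L ⊔ U : Submodule ℝ V), inner ℝ γ x ≠ 0 := by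
      by_contra! hcon
      have : x ∈ (span ℝ (roots G \ (L ⊔ U : Submodule ℝ V)))ᗮ :=
        mem_orthogonal_span hcon
      rw [span_roots_diff_eq_top hG hirr hess hM, top_orthogonal_eq_bot, mem_bot] at this
      exact hx0 this
    have hlt : L.map (refl γ).toLinearMap ⊓ U < L ⊓ U := by
      -- If `δ ∈ L` is reflected into `U`, the difference is a multiple of `γ` lying in `L ⊔ U`; as
      -- `γ` is outside, it vanishes and `δ` is fixed.
      have key : ∀ v ∈ L.map (refl γ).toLinearMap ⊓ U, v ∈ L ⊓ U ∧ inner ℝ γ v = 0 := by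
        rintro _ ⟨⟨δ, hδ, rfl⟩, hU⟩
        change refl γ δ ∈ U at hU
        change refl γ δ ∈ _ ∧ inner ℝ γ (refl γ δ) = 0
        have hδγ : inner ℝ γ δ = 0 := by
          by_contra h0
          refine hγ.2 ((smul_mem_iff _ (mul_ne_zero two_ne_zero h0)).1 ?_)
          have := sub_mem (mem_sup_left (T := U) hδ) (mem_sup_right (S := L) hU)
          rwa [refl_apply hγ.1.1, sub_sub_cancel] at this
        rw [refl_apply_of_inner_eq_zero hδγ] at hU ⊢
        exact ⟨⟨hδ, hU⟩, hδγ⟩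
      exact lt_of_le_of_ne (fun v hv => (key v hv).1) fun h => hne (key x (h ▸ hx)).2
    obtain ⟨g, hg, hgL⟩ := ih _ (hn ▸ finrank_lt_finrank_of_lt hlt)
      (L.map (refl γ).toLinearMap)
      (by
        rw [show finrank ℝ (L.map (refl γ).toLinearMap) = finrank ℝ L from
          LinearEquiv.finrank_map_eq (refl γ).toLinearEquiv L]
        exact hdim) rfl
    refine ⟨g * refl γ, G.mul_mem hg hγ.1.2, ?_⟩
    rw [← hgL, ← Submodule.map_comp]
    rfl

/-! ### Simple systems of parabolic subgroups and conjugates -/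

/-- In a simplicial cone, elements of the span of a face lie in that face. -/
lemma mem_hull_image_of_mem_span {B : Type*} {α : B → V} (hα : LinearIndependent ℝ α)
    {I : Set B} {x : V} (hx : x ∈ PointedCone.hull ℝ (Set.range α))
    (hxI : x ∈ span ℝ (α '' I)) : x ∈ PointedCone.hull ℝ (α '' I) := by
  obtain ⟨c, rfl⟩ := Finsupp.mem_span_range_iff_exists_finsupp.1 hx
  obtain ⟨l, hl, hlx⟩ := (Finsupp.mem_span_image_iff_linearCombination ℝ).1 hxI
  -- Linear independence makes the coefficients unique, so the nonnegative ones are supported in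
  -- `I`.
  have hc : l = c.mapRange (fun r : {c : ℝ // 0 ≤ c} => (r : ℝ)) rfl := by
    refine hα ?_
    rw [hlx, Finsupp.linearCombination_apply, Finsupp.sum_mapRange_index (by simp)]
    rfl
  refine sum_mem fun i hi => smul_mem _ _ (subset_span ⟨i, ?_, rfl⟩)
  refine hl (Finsupp.mem_support_iff.2 ?_)
  rw [hc, Finsupp.mapRange_apply]
  exact fun h => Finsupp.mem_support_iff.1 hi (Subtype.ext h)

/-- A subset of a simple system is a simple system of the parabolic subgroup it generates. -/
lemma isSimpleSystem_closure [FiniteDimensional ℝ V] {G : Subgroup (V ≃ₗᵢ[ℝ] V)} {B : Type*}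
    {α : B → V} (hα : Function.Injective α) (hΔ : IsSimpleSystem G (Set.range α)) (I : Set B) :
    IsSimpleSystem (Subgroup.closure (refl '' (α '' I))) (α '' I) := by
  have hli : LinearIndependent ℝ α := (linearIndepOn_id_range_iff hα).1 hΔ.2.1
  have hle : Subgroup.closure (refl '' (α '' I)) ≤ G := by
    rw [Subgroup.closure_le]
    rintro _ ⟨_, ⟨i, -, rfl⟩, rfl⟩
    exact (hΔ.1 ⟨i, rfl⟩).2
  refine ⟨?_, hΔ.2.1.mono (Set.image_subset_range α I), fun β hβ => ?_⟩
  · rintro _ ⟨i, hi, rfl⟩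
    exact ⟨(hΔ.1 ⟨i, rfl⟩).1, Subgroup.subset_closure ⟨_, ⟨i, hi, rfl⟩, rfl⟩⟩
  · have hspan := mem_span_of_mem_roots_closure hβ
    exact (hΔ.2.2 β (roots_mono hle hβ)).imp
      (fun h => mem_hull_image_of_mem_span hli h hspan)
      (fun h => mem_hull_image_of_mem_span hli h (neg_mem hspan))

lemma IsSimpleSystem.map {G : Subgroup (V ≃ₗᵢ[ℝ] V)} {Δ : Set V} (hΔ : IsSimpleSystem G Δ)
    {g : V ≃ₗᵢ[ℝ] V} (hg : g ∈ G) : IsSimpleSystem G (g '' Δ) := by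
  have hull : ∀ x, g⁻¹ x ∈ PointedCone.hull ℝ Δ → x ∈ PointedCone.hull ℝ (g '' Δ) := by
    intro x hx
    have h := Submodule.apply_mem_span_image_of_mem_span
      (g.toLinearMap.restrictScalars {c : ℝ // 0 ≤ c}) hx
    have hgx : g (g⁻¹ x) = x := g.apply_symm_apply x
    change g (g⁻¹ x) ∈ PointedCone.hull ℝ (g '' Δ) at h
    rwa [hgx] at h
  refine ⟨?_, ?_, fun β hβ => ?_⟩
  · rintro _ ⟨α, hα, rfl⟩
    exact map_mem_roots hg (hΔ.1 hα)
  · exact LinearIndepOn.id_image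
      (LinearIndependent.map' hΔ.2.1 g.toLinearMap (LinearMap.ker_eq_bot.2 g.injective))
  · refine (hΔ.2.2 _ (map_mem_roots (G.inv_mem hg) hβ)).imp (hull β) fun h => hull (-β) ?_
    rwa [map_neg]

/-- A root orthogonal to a point of a `k`-flat that lies in no `(k - 1)`-flat is orthogonal to
the whole flat. -/
lemma mem_orthogonal_flat [FiniteDimensional ℝ V] {G : Subgroup (V ≃ₗᵢ[ℝ] V)}
    {F : Submodule ℝ V} (hF : IsFlat G F) {p : V} (hpF : p ∈ F)
    (hp : p ∉ stratum G (finrank ℝ F - 1)) {β : V} (hβ : β ∈ roots G)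
    (hβp : inner ℝ β p = 0) : β ∈ Fᗮ := by
  by_contra hβF
  refine hp ⟨F ⊓ hyperplane β, ?_, ?_, hpF, mem_hyperplane_iff.2 hβp⟩
  · obtain ⟨S, hS, rfl⟩ := hF
    refine ⟨insert (hyperplane β) S, Set.insert_subset ⟨β, hβ, rfl⟩ hS, ?_⟩
    rw [sInf_insert, inf_comm]
  · have hlt : F ⊓ hyperplane β < F := inf_lt_left.2 fun h => hβF fun v hv => by
      rw [real_inner_comm]
      exact mem_hyperplane_iff.1 (h hv)
    have h1 := finrank_lt_finrank_of_lt hlt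
    have h2 := finrank_sup_add_finrank_inf_eq F (hyperplane β)
    have h3 := (F ⊔ hyperplane β).finrank_le
    have h4 := (span ℝ {β}).finrank_add_finrank_orthogonal
    rw [finrank_span_singleton (ne_zero_of_norm_eq_one hβ.1)] at h4
    change 1 + finrank ℝ (hyperplane β) = _ at h4
    omega

end ReflGroup

open ReflGroup Submodule in
theorem proposition5p2
    {V : Type*} [NormedAddCommGroup V] [InnerProductSpace ℝ V] [FiniteDimensional ℝ V]
    (G : Subgroup (V ≃ₗᵢ[ℝ] V))
    (hG : ReflGroup.IsReflectionGroup G)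
    (hirr : ReflGroup.IsIrreducible G)
    (hess : ReflGroup.IsEssential G)
    {B : Type*} (D : CoxeterMatrix B) (hD : ReflGroup.HasDynkinDiagram G D)
    (k : ℕ) (hk : 1 ≤ k)
    (p : V) (hp : p ∈ ReflGroup.stratum G k \ ReflGroup.stratum G (k - 1))
    (I : Finset B) (hcard : I.card = k)
    (hconn : (ReflGroup.diagramGraph (ReflGroup.subdiagram D I)).Connected) :
    ∃ W : Subgroup (V ≃ₗᵢ[ℝ] V),
      ReflGroup.IsParabolic G W ∧
      ReflGroup.HasDynkinDiagram W (ReflGroup.subdiagram D I) ∧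
      ReflGroup.IsGeneral W p := by
  classical
  obtain ⟨⟨F, hF, rfl, hpF⟩, hp'⟩ := hp
  obtain ⟨α, hα, hΔ, hD⟩ := hD
  have hdim : Module.finrank ℝ Fᗮ + Module.finrank ℝ (span ℝ (α '' I)) ≤ Module.finrank ℝ V := by
    have h1 := F.finrank_add_finrank_orthogonal
    have h2 := finrank_span_finset_le_card (R := ℝ) (I.image α)
    rw [Finset.coe_image, Finset.card_image_of_injective I hα, hcard] at h2
    change Module.finrank ℝ (span ℝ (α '' I)) ≤ _ at h2
    omega
  obtain ⟨g, hg, hgL⟩ := exists_map_inf_eq_bot hG hirr hess Fᗮ (span ℝ (α '' I)) hdim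
  have hgα : Function.Injective (g ∘ α) := g.injective.comp hα
  have hgΔ : IsSimpleSystem G (Set.range (g ∘ α)) := by
    rw [Set.range_comp]
    exact hΔ.map hg
  have hspan : (span ℝ (α '' I)).map g.toLinearMap = span ℝ ((g ∘ α) '' I) := by
    rw [Submodule.map_span, ← Set.image_comp]
    rfl
  have hunit : ∀ i, ‖α i‖ = 1 := fun i => (hΔ.1 ⟨i, rfl⟩).1
  refine ⟨Subgroup.closure (refl '' ((g ∘ α) '' I)),
    ⟨_, hgΔ, _, Set.image_subset_range _ _, rfl⟩,
    ⟨fun i => g (α i), hgα.comp Subtype.val_injective, ?_, fun i j => ?_⟩, ?_⟩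
  · have hrange : Set.range (fun i : I => g (α i)) = (g ∘ α) '' I := by
      ext x
      simp
    rw [hrange]
    exact isSimpleSystem_closure hgα hgΔ I
  · change D i j = _
    rw [hD, refl_map g (hunit _), refl_map g (hunit _)]
    have hconj : g * refl (α i) * g⁻¹ * (g * refl (α j) * g⁻¹) =
        MulAut.conj g (refl (α i) * refl (α j)) := by
      rw [MulAut.conj_apply]
      group
    rw [hconj, MulEquiv.orderOf_eq]
  · rintro _ ⟨β, hβ, rfl⟩ hpβ
    have hWG : Subgroup.closure (refl '' ((g ∘ α) '' I)) ≤ G := by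
      rw [Subgroup.closure_le]
      rintro _ ⟨_, ⟨i, -, rfl⟩, rfl⟩
      exact (hgΔ.1 ⟨i, rfl⟩).2
    -- A root of `W` orthogonal to `p` lies in both `g L` and `Fᗮ`, hence is zero, contradicting
    -- unit norm.
    have hmem : β ∈ (span ℝ (α '' I)).map g.toLinearMap ⊓ Fᗮ :=
      ⟨hspan ▸ mem_span_of_mem_roots_closure hβ,
        mem_orthogonal_flat hF hpF hp' (roots_mono hWG hβ) (mem_hyperplane_iff.1 hpβ)⟩
    rw [hgL, mem_bot] at hmem
    exact ne_zero_of_norm_eq_one hβ.1 hmem
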